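/- Let $n \ge 0$ and $q \ge 0$ be integers, let $P$ be the $2\times n$ rectangle of boxes, regarded as a poset in which each box is covered by the boxes immediately below it and immediately to its right, and put $d = \max(2n-q,0)$. Let $\mathrm{Inc}_q(P)$ be the set of increasing tableaux $T : P \to \{1,\dots,d\}$, that is, of the surjections $T$ onto $\{1,\dots,d\}$ such that $x<y$ in $P$ implies $T(x)<T(y)$. The K-promotion $\mathcal{P}_K(T)$ of $T \in \mathrm{Inc}_q(P)$ is formed as follows. Replace every label $1$ by a bullet $\bullet$. Then, for $i = 2,\dots,d$ in this order, apply $\mathtt{switch}_{i,\bullet}$: simultaneously, every box labeled $i$ that covers or is covered by a box labeled $\bullet$ is relabeled $\bullet$, and every box labeled $\bullet$ that covers or is covered by a box labeled $i$ is relabeled $i$. Finally reduce every numerical label by $1$ and replace every $\bullet$ by $d$. This is a bijection of $\mathrm{Inc}_q(P)$ onto itself; let $\mathcal{C} = \langle \mathcal{P}_K\rangle$ be the cyclic group that it generates. Let $S \subseteq P$ be a set of boxes that is mapped to itself by the $180^\circ$ rotation of the rectangle, and let $\sigma_S(T) = \sum_{s\in S} T(s)$. Then $(\mathrm{Inc}_q(P),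 \mathcal{C}, \sigma_S)$ is homomesic: all $\mathcal{C}$-orbits are finite, and for any two $\mathcal{C}$-orbits $\mathcal{O}_1,\mathcal{O}_2$ in $\mathrm{Inc}_q(P)$, $$\frac{1}{|\mathcal{O}_1|}\sum_{T\in\mathcal{O}_1}\sigma_S(T) = \frac{1}{|\mathcal{O}_2|}\sum_{T\in\mathcal{O}_2}\sigma_S(T).$$ -/

import Mathlib

/-- The triple `(X, G, ξ)` is homomesic: all orbits of `G` on `X` are finite, and the average of
the statistic `ξ` is the same on any two orbits. -/
def Homomesic (G : Type*) {X : Type*} [Group G] [MulAction G X] (ξ : X → ℂ) : Prop :=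
  (∀ x : X, (MulAction.orbit G x).Finite) ∧
    ∀ x y : X,
      (1 / ((MulAction.orbit G x).ncard : ℂ)) * ∑ᶠ z ∈ MulAction.orbit G x, ξ z =
        (1 / ((MulAction.orbit G y).ncard : ℂ)) * ∑ᶠ z ∈ MulAction.orbit G y, ξ z

/-- Increasing tableaux of shape `P`: strictly order-preserving surjections from `P` onto
`{1, …, |P| - q}`. -/
@[ext]
structure IncTableau (P : Type*) [PartialOrder P] [Fintype P] (q : ℕ) where
  entry : P → ℕ
  strictMono : StrictMono entry
  range_eq : Set.range entry = Set.Icc 1 (Fintype.card P - q)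

namespace KProm

section Operators

variable {P : Type*} [PartialOrder P]

/-- One of the two elements covers the other. -/
def CoverAdj (p r : P) : Prop := p ⋖ r ∨ r ⋖ p

open Classical in
/-- The operation `switch_{a,b}`: every element labeled `a` that covers or is covered by an
element labeled `b` is relabeled `b`, and simultaneously every element labeled `b` that covers or
is covered by an element labeled `a` is relabeled `a`. -/
noncomputable def switch {α : Type*} (a b : α) (f : P → α) : P → α := fun p =>
  if f p = a ∧ ∃ r, CoverAdj p r ∧ f r = b then b
  else if f p = b ∧ ∃ r, CoverAdj p r ∧ f r = a then a
  else f p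

/-- Replace each label `1` with a bullet. Bulleted labelings take values in `Option ℕ`, with
`none` as the bullet. -/
def addBullets (T : P → ℕ) : P → Option ℕ := fun p => if T p = 1 then none else some (T p)

/-- The result of `switch_{2,•}`, `switch_{3,•}`, …, `switch_{k+1,•}`, applied successively to the
labeling `T` with its `1`s replaced by bullets. -/
noncomputable def slide (T : P → ℕ) : ℕ → P → Option ℕ
  | 0 => addBullets T
  | k + 1 => switch (some (k + 2)) none (slide T k)

/-- Reduce each label by `1`, and replace each bullet with the label `d`. -/
def removeBullets (d : ℕ) (f : P → Option ℕ) : P → ℕ := fun p =>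
  match f p with
  | none => d
  | some j => j - 1

/-- K-promotion of a labeling by `{1, …, d}`: replace `1` by bullets, apply `switch_{i,•}` for
`i = 2, …, d` in this order, reduce the labels by `1` and replace the bullets by `d`. -/
noncomputable def kPromoteLabeling (d : ℕ) (T : P → ℕ) : P → ℕ :=
  removeBullets d (slide T (d - 1))

/-! Proof that K-promotion is a well-defined bijection on increasing tableaux: it is a product of
involutions `toggle i`, each of which exchanges the labels `i` and `i + 1` on the elements
that are not adjacent to an element with the other label. -/

open Classical in
/-- Exchange `i` and `i + 1` on the elements not adjacent to an element with the other label. -/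
noncomputable def toggle (i : ℕ) (T : P → ℕ) : P → ℕ := fun p =>
  if T p = i ∧ ¬ ∃ r, CoverAdj p r ∧ T r = i + 1 then i + 1
  else if T p = i + 1 ∧ ¬ ∃ r, CoverAdj p r ∧ T r = i then i
  else T p

/-- The composite of `toggle 1`, …, `toggle k`, in this order. -/
noncomputable def toggles (T : P → ℕ) : ℕ → P → ℕ
  | 0 => T
  | k + 1 => toggle (k + 1) (toggles T k)

/-- The bulleted labeling after `k` switches, in terms of the labeling after `k` toggles. -/
def encode {X : Type*} (k : ℕ) (L : X → ℕ) : X → Option ℕ := fun p =>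
  if L p = k + 1 then none else if L p ≤ k then some (L p + 1) else some (L p)

theorem encode_eq_none {X : Type*} (k : ℕ) (L : X → ℕ) (p : X) : encode k L p = none ↔ L p = k + 1 := by
  unfold encode; split_ifs <;> simp_all

theorem encode_eq_some {X : Type*} (k : ℕ) (L : X → ℕ) (p : X) :
    encode k L p = some (k + 2) ↔ L p = k + 2 := by
  unfold encode; split_ifs <;> simp_all
  omega

theorem switch_encode (k : ℕ) (L : P → ℕ) :
    switch (some (k + 2)) none (encode k L) = encode (k + 1) (toggle (k + 1) L) := by
  classical
  funext p
  have hn : ∀ r, encode k L r = none ↔ L r = k + 1 := encode_eq_none k L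
  have hs : ∀ r, encode k L r = some (k + 2) ↔ L r = k + 2 := encode_eq_some k L
  simp only [switch, hn, hs]
  by_cases h1 : L p = k + 1
  · by_cases h2 : ∃ r, CoverAdj p r ∧ L r = k + 2
    · simp [encode, toggle, h1, h2]
    · simp [encode, toggle, h1, h2]
  · by_cases h3 : L p = k + 2
    · by_cases h2 : ∃ r, CoverAdj p r ∧ L r = k + 1
      · simp [encode, toggle, h3, h2]
      · simp [encode, toggle, h3, h2]
    · have ht : toggle (k + 1) L p = L p := by simp [toggle, h1, h3]
      simp only [encode, ht, h1, h3, false_and, if_false]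
      by_cases h5 : L p ≤ k
      · simp [h5, Nat.le_succ_of_le h5]
      · have h6 : ¬ L p ≤ k + 1 := by omega
        simp [h5, h6]

theorem slide_eq (T : P → ℕ) (hT : ∀ p, 1 ≤ T p) (k : ℕ) :
    slide T k = encode k (toggles T k) := by
  induction k with
  | zero =>
    funext p
    have := hT p
    by_cases h : T p = 1
    · simp [slide, addBullets, encode, toggles, h]
    · have h0 : T p ≠ 0 := by omega
      simp [slide, addBullets, encode, toggles, h, h0]
  | succ k ih => rw [slide, ih, switch_encode, toggles]

/-- Strictly increasing labelings with set of labels `{1, …, d}`. -/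
def IsInc (d : ℕ) (T : P → ℕ) : Prop := StrictMono T ∧ Set.range T = Set.Icc 1 d

theorem covBy_of_consecutive {T : P → ℕ} (hT : StrictMono T) {x y : P} (hxy : x < y)
    (h : T y = T x + 1) : x ⋖ y :=
  ⟨hxy, fun z hxz hzy => by have := hT hxz; have := hT hzy; omega⟩

theorem toggle_toggle {T : P → ℕ} (hT : StrictMono T) (i : ℕ) : toggle i (toggle i T) = T := by
  have hne : ∀ {p r : P}, CoverAdj p r → T p ≠ T r := by
    rintro p r (h | h)
    · exact (hT h.lt).ne
    · exact (hT h.lt).ne'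
  have hsymm : ∀ {p r : P}, CoverAdj p r → CoverAdj r p := fun h => Or.symm h
  have key1 : ∀ p, T p = i → (∃ r, CoverAdj p r ∧ T r = i + 1) → toggle i T p = i := by
    intro p h1 h2; simp [toggle, h1, h2]
  have key2 : ∀ p, T p = i + 1 → (∃ r, CoverAdj p r ∧ T r = i) → toggle i T p = i + 1 := by
    intro p h1 h2; simp [toggle, h1, h2]
  have key3 : ∀ p, T p = i → (¬ ∃ r, CoverAdj p r ∧ T r = i + 1) → toggle i T p = i + 1 := by
    intro p h1 h2; simp only [toggle, h1, h2, not_false_iff, and_self, if_true]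
  have key4 : ∀ p, T p = i + 1 → (¬ ∃ r, CoverAdj p r ∧ T r = i) → toggle i T p = i := by
    intro p h1 h2; simp [toggle, h1, h2]
  have key5 : ∀ p, T p ≠ i → T p ≠ i + 1 → toggle i T p = T p := by
    intro p h1 h2; simp [toggle, h1, h2]
  funext p
  by_cases h1 : T p = i
  · by_cases h2 : ∃ r, CoverAdj p r ∧ T r = i + 1
    · obtain ⟨r, hr, hr'⟩ := h2
      have e1 := key1 p h1 ⟨r, hr, hr'⟩
      have e2 := key2 r hr' ⟨p, hsymm hr, h1⟩
      have : ∃ r, CoverAdj p r ∧ toggle i T r = i + 1 := ⟨r, hr, e2⟩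
      rw [toggle]; simp [e1, this, h1]
    · have e1 := key3 p h1 h2
      have : ¬ ∃ r, CoverAdj p r ∧ toggle i T r = i := by
        rintro ⟨r, hr, hr'⟩
        have n1 : T r ≠ i := fun h => hne hr (h1.trans h.symm)
        have n2 : T r ≠ i + 1 := fun h => h2 ⟨r, hr, h⟩
        exact n1 (key5 r n1 n2 ▸ hr')
      rw [toggle]; simp [e1, this, h1]
  · by_cases h3 : T p = i + 1
    · by_cases h2 : ∃ r, CoverAdj p r ∧ T r = i
      · obtain ⟨r, hr, hr'⟩ := h2
        have e1 := key2 p h3 ⟨r, hr, hr'⟩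
        have e2 := key1 r hr' ⟨p, hsymm hr, h3⟩
        have : ∃ r, CoverAdj p r ∧ toggle i T r = i := ⟨r, hr, e2⟩
        rw [toggle]; simp [e1, this, h3]
      · have e1 := key4 p h3 h2
        have : ¬ ∃ r, CoverAdj p r ∧ toggle i T r = i + 1 := by
          rintro ⟨r, hr, hr'⟩
          have n1 : T r ≠ i + 1 := fun h => hne hr (h3.trans h.symm)
          have n2 : T r ≠ i := fun h => h2 ⟨r, hr, h⟩
          exact n1 (key5 r n2 n1 ▸ hr')
        rw [toggle]; simp only [e1, this, h3, not_false_iff, and_self, if_true]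
    · have e := key5 p h1 h3
      rw [toggle]; simp [e, h1, h3]

theorem toggle_strictMono {T : P → ℕ} (hT : StrictMono T) (i : ℕ) : StrictMono (toggle i T) := by
  intro x y hxy
  have h := hT hxy
  have hcov : T x = i → T y = i + 1 → CoverAdj x y := fun h1 h2 =>
    Or.inl (covBy_of_consecutive hT hxy (by omega))
  have hA : T x = i → T y = i + 1 → ∃ r, CoverAdj x r ∧ T r = i + 1 := fun h1 h2 =>
    ⟨y, hcov h1 h2, h2⟩
  have hB : T x = i → T y = i + 1 → ∃ r, CoverAdj y r ∧ T r = i := fun h1 h2 =>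
    ⟨x, Or.symm (hcov h1 h2), h1⟩
  unfold toggle
  generalize (∃ r, CoverAdj x r ∧ T r = i + 1) = A at *
  generalize (∃ r, CoverAdj y r ∧ T r = i) = B at *
  split_ifs <;> grind

theorem toggle_isInc {d : ℕ} {T : P → ℕ} (hT : IsInc d T) {i : ℕ} (h1 : 1 ≤ i) (h2 : i + 1 ≤ d) :
    IsInc d (toggle i T) := by
  refine ⟨toggle_strictMono hT.1 i, ?_⟩
  have hr := hT.2
  apply Set.Subset.antisymm
  · rintro _ ⟨p, rfl⟩
    have hm : T p ∈ Set.Icc 1 d := hr ▸ Set.mem_range_self p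
    have := hm.1; have := hm.2
    unfold toggle
    simp only [Set.mem_Icc]
    split_ifs <;> omega
  · intro j hj
    obtain ⟨p, hp⟩ : j ∈ Set.range T := hr ▸ hj
    obtain ⟨x, hx⟩ : i ∈ Set.range T := hr ▸ ⟨h1, by omega⟩
    obtain ⟨y, hy⟩ : i + 1 ∈ Set.range T := hr ▸ ⟨by omega, h2⟩
    by_cases hj1 : j = i
    · subst hj1
      by_cases hc : ∃ r, CoverAdj y r ∧ T r = j
      · obtain ⟨r, hyr, hrj⟩ := hc
        have : ∃ s, CoverAdj r s ∧ T s = j + 1 := ⟨y, Or.symm hyr, hy⟩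
        exact ⟨r, by simp [toggle, hrj, this]⟩
      · exact ⟨y, by simp [toggle, hy, hc]⟩
    · by_cases hj2 : j = i + 1
      · subst hj2
        by_cases hc : ∃ r, CoverAdj x r ∧ T r = i + 1
        · obtain ⟨r, hxr, hri⟩ := hc
          have : ∃ s, CoverAdj r s ∧ T s = i := ⟨x, Or.symm hxr, hx⟩
          exact ⟨r, by simp [toggle, hri, this]⟩
        · exact ⟨x, by simp only [toggle, hx, hc, not_false_iff, and_self, if_true]⟩
      · exact ⟨p, by simp [toggle, hp, hj1, hj2]⟩

theorem toggles_isInc {d : ℕ} {T : P → ℕ} (hT : IsInc d T) (k : ℕ) (hk : k ≤ d - 1) :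
    IsInc d (toggles T k) := by
  induction k with
  | zero => exact hT
  | succ k ih => exact toggle_isInc (ih (by omega)) (by omega) (by omega)

theorem kPromoteLabeling_eq {d : ℕ} {T : P → ℕ} (hT : IsInc d T) :
    kPromoteLabeling d T = toggles T (d - 1) := by
  have h1 : ∀ p, 1 ≤ T p := fun p =>
    (show T p ∈ Set.Icc 1 d from hT.2 ▸ Set.mem_range_self p).1
  funext p
  have hp : toggles T (d - 1) p ∈ Set.Icc 1 d :=
    (toggles_isInc hT (d - 1) le_rfl).2 ▸ Set.mem_range_self p
  have := hp.1; have := hp.2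
  unfold kPromoteLabeling removeBullets
  rw [slide_eq T h1]
  unfold encode
  split_ifs <;> simp <;> omega

theorem toggles_injOn {d : ℕ} (k : ℕ) (hk : k ≤ d - 1) {T U : P → ℕ} (hT : IsInc d T)
    (hU : IsInc d U) (h : toggles T k = toggles U k) : T = U := by
  induction k with
  | zero => exact h
  | succ k ih =>
    apply ih (by omega)
    have := congrArg (toggle (k + 1)) h
    rwa [toggles, toggles, toggle_toggle (toggles_isInc hT k (by omega)).1,
      toggle_toggle (toggles_isInc hU k (by omega)).1] at this

theorem toggles_surjOn {d : ℕ} (k : ℕ) (hk : k ≤ d - 1) {U : P → ℕ} (hU : IsInc d U) :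
    ∃ T : P → ℕ, IsInc d T ∧ toggles T k = U := by
  induction k generalizing U with
  | zero => exact ⟨U, hU, rfl⟩
  | succ k ih =>
    obtain ⟨T, hT, h⟩ := ih (by omega) (toggle_isInc hU (i := k + 1) (by omega) (by omega))
    exact ⟨T, hT, by rw [toggles, h, toggle_toggle hU.1]⟩

end Operators

end KProm

namespace IncTableau

variable {P : Type*} [PartialOrder P] [Fintype P] {q : ℕ}

theorem isInc (T : IncTableau P q) : KProm.IsInc (Fintype.card P - q) T.entry :=
  ⟨T.strictMono, T.range_eq⟩

theorem isInc_kPromote (T : IncTableau P q) :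
    KProm.IsInc (Fintype.card P - q) (KProm.kPromoteLabeling (Fintype.card P - q) T.entry) := by
  rw [KProm.kPromoteLabeling_eq T.isInc]
  exact KProm.toggles_isInc T.isInc _ le_rfl

/-- K-promotion of an increasing tableau. -/
noncomputable def kPromote (T : IncTableau P q) : IncTableau P q where
  entry := KProm.kPromoteLabeling (Fintype.card P - q) T.entry
  strictMono := T.isInc_kPromote.1
  range_eq := T.isInc_kPromote.2

theorem kPromote_bijective : Function.Bijective (kPromote : IncTableau P q → IncTableau P q) := by
  constructor
  · intro T U h
    have h' := congrArg IncTableau.entry h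
    simp only [kPromote, KProm.kPromoteLabeling_eq T.isInc,
      KProm.kPromoteLabeling_eq U.isInc] at h'
    exact IncTableau.ext (KProm.toggles_injOn _ le_rfl T.isInc U.isInc h')
  · intro U
    obtain ⟨T, hT, h⟩ := KProm.toggles_surjOn _ le_rfl U.isInc
    refine ⟨⟨T, hT.1, hT.2⟩, IncTableau.ext ?_⟩
    simp only [kPromote, KProm.kPromoteLabeling_eq hT, h]

/-- K-promotion as a permutation of the set of increasing tableaux. -/
noncomputable def kPromotion (P : Type*) [PartialOrder P] [Fintype P] (q : ℕ) :
    Equiv.Perm (IncTableau P q) :=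
  Equiv.ofBijective kPromote kPromote_bijective

/-- The statistic `σ_S`: the sum of the entries in the boxes of `S`. -/
def sigma (S : Finset P) (T : IncTableau P q) : ℂ := ∑ s ∈ S, (T.entry s : ℂ)

end IncTableau

/-- The `180°` rotation of the `m × n` rectangle (box `(i, j)` lies in row `i`, column `j`; the
product order makes each box covered by the boxes immediately below it and to its right). -/
def rotateBox {m n : ℕ} (b : Fin m × Fin n) : Fin m × Fin n := (b.1.rev, b.2.rev)

/-! Let `d` be the largest label, `T_k` the `k`-th promotion of `T`, and `α_k`, `β_k` the row counts
of `T_k`. Everything rests on the identity `β_k (d - k) + α_0 k = n` for `k ≤ d`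
(`TwoRowPath.snd_add_fst`). As rows increase, it says that `T (0, c) ≤ k` exactly when the antipodal
entry of `T_k` exceeds `d - k`. Summed over `k = 0, …, d` and over an orbit, which `k` promotions
merely permute, this gives each antipodal pair of boxes the average `d + 1`. A rotation-invariant
`S` therefore has average `|S| (d + 1) / 2` on every orbit.

For the identity, the left side equals `n` at `k = 0` and at `k = d`, so it suffices that it never
decreases. By the promotion rule (`promotes_kPromoteLabeling`), the `β` term loses one exactly when
the bullet of `T_k` reaches the second row by label `d - k`. This must not happen when `k + 1` is
missing from the first row of `T` (`not_drops_of_eq`). There the noncrossing partition enters: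
promotion shifts its links down by one, and a label that newly appears in the first row is linked to
`d`. Once such a link starts at label `1`, it keeps the bullet in the first row up to its other end.
-/

/-! ### Promotion dynamics of row counts -/

/-- The row-count functions of a two-row rectangular increasing tableau: `α p` and `β p` are the
numbers of labels at most `p` in the first and in the second row. -/
structure TwoRowPath (n d : ℕ) (α β : ℕ → ℕ) : Prop where
  fst_zero : α 0 = 0
  snd_zero : β 0 = 0
  fst_one : α 1 = 1
  fst_mono : ∀ p, α p ≤ α (p + 1)
  fst_step : ∀ p, α (p + 1) ≤ α p + 1
  snd_mono : ∀ p, β p ≤ β (p + 1)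
  snd_step : ∀ p, β (p + 1) ≤ β p + 1
  snd_le : ∀ p, β (p + 1) ≤ α p
  fst_top : ∀ p, d ≤ p → α p = n
  snd_top : ∀ p, d ≤ p → β p = n

namespace TwoRowPath

/-- By label `p`, the promotion bullet has reached the second row. -/
def Drops (α β : ℕ → ℕ) (p : ℕ) : Prop := ∃ m, 1 ≤ m ∧ m + 1 ≤ p ∧ β (m + 1) = α m

/-- By label `p`, the promotion bullet has left the first row. -/
def Leaves (α β : ℕ → ℕ) (p : ℕ) : Prop := ∃ m, 1 ≤ m ∧ m ≤ p ∧ β m = α m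

theorem not_drops_one (α β : ℕ → ℕ) : ¬ Drops α β 1 := by
  rintro ⟨m, h1, h2, -⟩; omega

theorem Drops.mono {α β : ℕ → ℕ} {p r : ℕ} (h : Drops α β p) (hpr : p ≤ r) : Drops α β r := by
  obtain ⟨m, h1, h2, h3⟩ := h; exact ⟨m, h1, by omega, h3⟩

theorem Leaves.mono {α β : ℕ → ℕ} {p r : ℕ} (h : Leaves α β p) (hpr : p ≤ r) :
    Leaves α β r := by
  obtain ⟨m, h1, h2, h3⟩ := h; exact ⟨m, h1, by omega, h3⟩

theorem drops_succ {α β : ℕ → ℕ} {p : ℕ} (hp : 1 ≤ p) :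
    Drops α β (p + 1) ↔ Drops α β p ∨ β (p + 1) = α p := by
  constructor
  · rintro ⟨m, h1, h2, h3⟩
    rcases Nat.lt_or_ge m p with h | h
    · exact Or.inl ⟨m, h1, h, h3⟩
    · obtain rfl : m = p := by omega
      exact Or.inr h3
  · rintro (h | h)
    · exact h.mono (Nat.le_succ p)
    · exact ⟨p, hp, le_rfl, h⟩

theorem leaves_succ {α β : ℕ → ℕ} {p : ℕ} :
    Leaves α β (p + 1) ↔ Leaves α β p ∨ β (p + 1) = α (p + 1) := by
  constructor
  · rintro ⟨m, h1, h2, h3⟩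
    rcases Nat.lt_or_ge m (p + 1) with h | h
    · exact Or.inl ⟨m, h1, by omega, h3⟩
    · obtain rfl : m = p + 1 := by omega
      exact Or.inr h3
  · rintro (h | h)
    · exact h.mono (Nat.le_succ p)
    · exact ⟨p + 1, by omega, le_rfl, h⟩

open Classical in
/-- `(α', β')` are the row-count functions of the promotion of a tableau with row-count functions
`(α, β)`. -/
def Promotes (d : ℕ) (α β α' β' : ℕ → ℕ) : Prop :=
  ∀ i < d, α' i + 1 = α (i + 1) + (if Leaves α β (i + 1) then 1 else 0) ∧
    β' i + (if Drops α β (i + 1) then 1 else 0) = β (i + 1)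

/-- In the noncrossing partition attached to the tableau, `f + 1` succeeds `m + 1` in its block. -/
structure Link (α β : ℕ → ℕ) (m f : ℕ) : Prop where
  le : m + 1 ≤ f
  mem : α (m + 1) = α m + 1
  lt : ∀ s, m + 1 ≤ s → s < f → β (s + 1) + α m < α s + β (m + 1)
  eq : β (f + 1) + α m = α f + β (m + 1)

/-- A link only involves differences of row counts, and over its span the corrections in `Promotes`
are constant (`hA`, `hC`), so they cancel. A first drop strictly inside the span would need `β (r +
1) = α r`, against the strict inequality of the link and `snd_le`; at its far end, equality would
force a drop already at its start. -/
theorem Link.promotes {n d m f : ℕ} {α β α' β' : ℕ → ℕ} (h : TwoRowPath n d α β)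
    (hP : Promotes d α β α' β') (hl : Link α β (m + 1) (f + 1)) (hf : f + 2 ≤ d) :
    Link α' β' m f := by
  classical
  have hle := hl.le
  have hA : ∀ s, m + 1 ≤ s → s ≤ f → (Drops α β (s + 2) ↔ Drops α β (m + 2)) := by
    intro s h1 h2
    refine ⟨fun hs => ?_, fun hs => hs.mono (by omega)⟩
    obtain ⟨r, r1, r2, r3⟩ := hs
    by_contra hm
    have hr : m + 2 ≤ r := by
      by_contra hr
      exact hm ⟨r, r1, by omega, r3⟩
    have e1 : β (m + 2) ≠ α (m + 1) := fun e => hm ⟨m + 1, by omega, by omega, e⟩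
    have e2 : β (m + 2) ≤ α (m + 1) := h.snd_le (m + 1)
    rcases Nat.lt_or_ge r (f + 1) with h3 | h3
    · have : β (r + 1) + α (m + 1) < α r + β (m + 2) := hl.lt r hr h3
      omega
    · obtain rfl : r = f + 1 := by omega
      have : β (f + 1 + 1) + α (m + 1) = α (f + 1) + β (m + 2) := hl.eq
      omega
  have hC : ∀ s, m + 1 ≤ s → s ≤ f → (Leaves α β (s + 1) ↔ Leaves α β (m + 1)) := by
    intro s h1 h2
    refine ⟨fun hs => ?_, fun hs => hs.mono (by omega)⟩
    obtain ⟨r, r1, r2, r3⟩ := hs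
    by_contra hm
    have hr : m + 2 ≤ r := by
      by_contra hr
      exact hm ⟨r, r1, by omega, r3⟩
    have e2 : β (m + 2) ≤ α (m + 1) := h.snd_le (m + 1)
    have e3 := hl.mem
    obtain ⟨t, rfl⟩ : ∃ t, r = t + 1 := ⟨r - 1, by omega⟩
    rcases Nat.lt_or_ge (m + 1) t with h3 | h3
    · have := hl.lt t (by omega) (by omega)
      have := h.fst_mono t
      simp only [Nat.add_assoc, Nat.reduceAdd] at *
      omega
    -- At the start of the span the strict inequality is unavailable; instead `m + 2` lies in the
    -- first row, so `β (m + 2) ≤ α (m + 1) < α (m + 2)`.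
    · obtain rfl : t = m + 1 := by omega
      simp only [Nat.add_assoc, Nat.reduceAdd] at *
      omega
  have hmem := hl.mem
  simp only [Nat.add_assoc, Nat.reduceAdd] at *
  have pm := hP m (by omega)
  have pm1 := hP (m + 1) (by omega)
  refine ⟨by omega, ?_, ?_, ?_⟩
  · have := hC (m + 1) (by omega) (by omega)
    simp only [Nat.add_assoc, Nat.reduceAdd] at *
    rw [if_congr this rfl rfl] at pm1
    omega
  · intro s h1 h2
    have ps := hP s (by omega)
    have ps1 := hP (s + 1) (by omega)
    have a1 := hA s h1 h2.le
    have c1 := hC s h1 (by omega)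
    have := hl.lt (s + 1) (by omega) (by omega)
    simp only [Nat.add_assoc, Nat.reduceAdd] at *
    rw [if_congr a1 rfl rfl] at ps1
    rw [if_congr c1 rfl rfl] at ps
    omega
  · have ps := hP f (by omega)
    have ps1 := hP (f + 1) (by omega)
    have a1 := hA f (by omega) le_rfl
    have c1 := hC f (by omega) le_rfl
    have := hl.eq
    simp only [Nat.add_assoc, Nat.reduceAdd] at *
    rw [if_congr a1 rfl rfl] at ps1
    rw [if_congr c1 rfl rfl] at ps
    omega

/-- A label can newly appear in the first row only if the bullet leaves that row exactly at `m + 2`.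
Then `β (m + 2) = α (m + 2) = α (m + 1)`, so the bullet has also dropped, both corrections are
constant from there on, and the link inequality reduces to `snd_le`. -/
theorem Promotes.link {n d m : ℕ} {α β α' β' : ℕ → ℕ} (h : TwoRowPath n d α β)
    (h' : TwoRowPath n d α' β') (hP : Promotes d α β α' β') (hm : m + 2 ≤ d)
    (h1 : α (m + 2) = α (m + 1)) (h2 : α' (m + 1) ≠ α' m) : Link α' β' m (d - 1) := by
  classical
  have h3 : α' (m + 1) = α' m + 1 := by
    have := h'.fst_step m; have := h'.fst_mono m; omega
  have pm := hP m (by omega)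
  have pm1 := hP (m + 1) (by omega)
  have hl := leaves_succ (α := α) (β := β) (p := m + 1)
  simp only [Nat.add_assoc, Nat.reduceAdd] at *
  have hc : ¬ Leaves α β (m + 1) ∧ Leaves α β (m + 2) := by
    split_ifs at pm pm1 <;> first | omega | tauto
  have hb : β (m + 2) = α (m + 2) := by tauto
  have ha : Drops α β (m + 2) := ⟨m + 1, by omega, by omega, hb.trans h1⟩
  rw [if_neg hc.1] at pm
  rw [if_pos hc.2, if_pos ha] at pm1
  refine ⟨by omega, h3, ?_, ?_⟩
  · intro s hs hsd
    have ps := hP s (by omega)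
    have ps1 := hP (s + 1) (by omega)
    rw [if_pos (hc.2.mono (by omega))] at ps
    rw [if_pos (ha.mono (by omega))] at ps1
    have := h.snd_le (s + 1)
    omega
  · have ps := hP (d - 1) (by omega)
    rw [if_pos (hc.2.mono (by omega))] at ps
    -- `Promotes` is silent at index `d`; there the counts are `n`.
    have e : d - 1 + 1 = d := by omega
    rw [e] at ps ⊢
    have := h.fst_top d le_rfl
    have := h'.snd_top d le_rfl
    omega

theorem Link.not_drops {n d f p : ℕ} {α β : ℕ → ℕ} (h : TwoRowPath n d α β) (hl : Link α β 0 f)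
    (hp : p ≤ f) : ¬ Drops α β p := by
  rintro ⟨m, h1, h2, h3⟩
  have := hl.lt m h1 (by omega)
  have := h.fst_zero
  have := h.snd_le 0
  simp only [Nat.zero_add] at *
  omega

theorem Link.iterate {n d : ℕ} {α β : ℕ → ℕ → ℕ} (h : ∀ k, TwoRowPath n d (α k) (β k))
    (hP : ∀ k, Promotes d (α k) (β k) (α (k + 1)) (β (k + 1))) (m : ℕ) :
    ∀ k f, f + 1 ≤ d → Link (α k) (β k) m f → Link (α (k + m)) (β (k + m)) 0 (f - m) := by
  induction m with
  | zero => exact fun k f _ hl => hl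
  | succ m ih =>
    intro k f hf hl
    obtain ⟨f, rfl⟩ : ∃ t, f = t + 1 := ⟨f - 1, by have := hl.le; omega⟩
    have := ih (k + 1) f (by omega) (hl.promotes (h k) (hP k) (by omega))
    rwa [show k + (m + 1) = k + 1 + m by omega, Nat.add_sub_add_right]

/-- Follow the missing label `m + 1` as promotion lowers it. It must enter the first row before or
on becoming `1`, since `α 1 = 1`. On entering it is linked to `d`, and the remaining promotions
carry this link to one from `1` to `d - m + 1` for the `m` of the statement. -/
theorem not_drops_of_eq {n d : ℕ} {α β : ℕ → ℕ → ℕ} (h : ∀ k, TwoRowPath n d (α k) (β k))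
    (hP : ∀ k, Promotes d (α k) (β k) (α (k + 1)) (β (k + 1))) (m : ℕ) :
    ∀ k, m + 1 ≤ d → α k (m + 1) = α k m → ¬ Drops (α (k + m)) (β (k + m)) (d - m) := by
  induction m with
  | zero =>
    intro k _ e
    have := (h k).fst_zero; have := (h k).fst_one
    simp only [Nat.zero_add] at e
    omega
  | succ m ih =>
    intro k hm e hd
    rw [show k + (m + 1) = k + 1 + m by omega] at hd
    by_cases e' : α (k + 1) (m + 1) = α (k + 1) m
    · exact ih (k + 1) (by omega) e' (hd.mono (by omega))
    · have hl := (hP k).link (h k) (h (k + 1)) (by omega) e e'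
      exact (hl.iterate h hP m (k + 1) (d - 1) (by omega)).not_drops (h _) (by omega) hd

/-- A quantity that is monotone in `k` and takes the same value at both ends is constant; only one
direction of the drop criterion is needed. -/
theorem snd_add_fst {n d : ℕ} {α β : ℕ → ℕ → ℕ} (h : ∀ k, TwoRowPath n d (α k) (β k))
    (hP : ∀ k, Promotes d (α k) (β k) (α (k + 1)) (β (k + 1))) {k : ℕ} (hk : k ≤ d) :
    β k (d - k) + α 0 k = n := by
  classical
  have mono : ∀ k < d, β k (d - k) + α 0 k ≤ β (k + 1) (d - (k + 1)) + α 0 (k + 1) := by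
    intro k hk
    have p := (hP k (d - (k + 1)) (by omega)).2
    rw [show d - (k + 1) + 1 = d - k by omega] at p
    have := (h 0).fst_mono k
    by_cases e : α 0 (k + 1) = α 0 k
    · have := not_drops_of_eq h hP k 0 hk e
      rw [Nat.zero_add] at this
      rw [if_neg this] at p
      omega
    · split_ifs at p <;> omega
  have lower : ∀ k ≤ d, n ≤ β k (d - k) + α 0 k := by
    intro k
    induction k with
    | zero => intro _; have := (h 0).snd_top d le_rfl; simp only [Nat.sub_zero]; omega
    | succ k ih => intro hk; exact (ih (by omega)).trans (mono k hk)
  have upper : ∀ j ≤ d, β (d - j) (d - (d - j)) + α 0 (d - j) ≤ n := by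
    intro j
    induction j with
    | zero =>
      intro _
      have := (h 0).fst_top d le_rfl; have := (h d).snd_zero
      simp only [Nat.sub_zero, Nat.sub_self]; omega
    | succ j ih =>
      intro hj
      have := mono (d - (j + 1)) (by omega)
      rw [show d - (j + 1) + 1 = d - j by omega] at this
      exact this.trans (ih (by omega))
  have u := upper (d - k) (by omega)
  rw [Nat.sub_sub_self hk] at u
  exact le_antisymm u (lower k hk)

end TwoRowPath

/-! ### Row counts of increasing labelings -/

open KProm

/-- The number of labels at most `p` in row `r`. -/
def rowCount {m n : ℕ} (L : Fin m × Fin n → ℕ) (r : Fin m) (p : ℕ) : ℕ :=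
  (Finset.univ.filter fun c : Fin n => L (r, c) ≤ p).card

section RowCount

variable {m n : ℕ} {L : Fin m × Fin n → ℕ}

theorem rowCount_le (r : Fin m) (p : ℕ) : rowCount L r p ≤ n :=
  (Finset.card_le_univ _).trans (by simp)

theorem strictMono_row (hL : StrictMono L) (r : Fin m) : StrictMono fun c : Fin n => L (r, c) :=
  fun _ _ h => hL (Prod.mk_lt_mk_iff_right.2 h)

/-- The labels at most `p` fill an initial segment of the row, and columns are numbered from `0`. -/
theorem entry_le_iff (hL : StrictMono L) (r : Fin m) (c : Fin n) (p : ℕ) :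
    L (r, c) ≤ p ↔ (c : ℕ) < rowCount L r p := by
  have hm : ∀ {a b : Fin n}, L (r, a) ≤ L (r, b) ↔ a ≤ b := (strictMono_row hL r).le_iff_le
  constructor
  · intro h
    have : Finset.Iic c ⊆ Finset.univ.filter fun c : Fin n => L (r, c) ≤ p := by
      intro x hx
      simp only [Finset.mem_filter, Finset.mem_univ, true_and]
      exact (hm.2 (Finset.mem_Iic.1 hx)).trans h
    have := Finset.card_le_card this
    rw [Fin.card_Iic] at this
    exact this
  · intro h
    by_contra hc
    have : (Finset.univ.filter fun c : Fin n => L (r, c) ≤ p) ⊆ Finset.Iio c := by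
      intro x hx
      simp only [Finset.mem_filter, Finset.mem_univ, true_and] at hx
      rw [Finset.mem_Iio]
      by_contra hx'
      exact hc ((hm.2 (not_lt.1 hx')).trans hx)
    have := Finset.card_le_card this
    rw [Fin.card_Iio] at this
    exact absurd h (not_lt.2 this)

theorem entry_eq_iff (hL : StrictMono L) (r : Fin m) (c : Fin n) (p : ℕ) :
    L (r, c) = p + 1 ↔ (c : ℕ) < rowCount L r (p + 1) ∧ rowCount L r p ≤ c := by
  have h1 := entry_le_iff hL r c (p + 1)
  have h2 := entry_le_iff hL r c p
  omega

theorem rowCount_mono (r : Fin m) {p p' : ℕ} (h : p ≤ p') : rowCount L r p ≤ rowCount L r p' :=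
  Finset.card_le_card fun c hc => by
    simp only [Finset.mem_filter, Finset.mem_univ, true_and] at hc ⊢
    exact hc.trans h

theorem rowCount_succ_le (hL : StrictMono L) (r : Fin m) (p : ℕ) :
    rowCount L r (p + 1) ≤ rowCount L r p + 1 := by
  by_contra! h
  have hn := rowCount_le (L := L) r (p + 1)
  let c : Fin n := ⟨rowCount L r p, by omega⟩
  let c' : Fin n := ⟨rowCount L r p + 1, by omega⟩
  have h1 := (entry_eq_iff hL r c p).2 ⟨by simp only [c]; omega, le_rfl⟩
  have h2 := (entry_le_iff hL r c' (p + 1)).2 h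
  have h3 : L (r, c) < L (r, c') := strictMono_row hL r (Fin.mk_lt_mk.2 (Nat.lt_succ_self _))
  omega

end RowCount

/-! ### Toggles and promotion in two rows -/

section TwoRows

variable {n d : ℕ}

theorem twoRowPath {T : Fin 2 × Fin n → ℕ} (hT : IsInc d T) (hn : 0 < n) :
    TwoRowPath n d (rowCount T 0) (rowCount T 1) := by
  have hL := hT.1
  have mem : ∀ x, 1 ≤ T x ∧ T x ≤ d := fun x =>
    (hT.2 ▸ Set.mem_range_self x : T x ∈ Set.Icc 1 d)
  have zero : ∀ r, rowCount T r 0 = 0 := by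
    intro r
    rw [rowCount, Finset.card_eq_zero, Finset.filter_eq_empty_iff]
    intro c _
    have := (mem (r, c)).1
    omega
  have top : ∀ r p, d ≤ p → rowCount T r p = n := by
    intro r p hp
    rw [rowCount, Finset.filter_true_of_mem, Finset.card_univ, Fintype.card_fin]
    intro c _
    exact (mem (r, c)).2.trans hp
  have one : 0 < rowCount T 0 1 := by
    let c : Fin n := ⟨0, hn⟩
    obtain ⟨x, hx⟩ : 1 ∈ Set.range T := by
      rw [hT.2]
      exact ⟨le_rfl, (mem (0, c)).1.trans (mem (0, c)).2⟩
    have : T (0, c) ≤ T x := hL.monotone ⟨Fin.zero_le _, Fin.mk_le_of_le_val (Nat.zero_le _)⟩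
    exact (entry_le_iff hL 0 c 1).1 (this.trans hx.le)
  refine ⟨zero 0, zero 1, ?_, fun p => rowCount_mono 0 p.le_succ, rowCount_succ_le hL 0,
    fun p => rowCount_mono 1 p.le_succ, rowCount_succ_le hL 1, ?_, top 0, top 1⟩
  · have : rowCount T 0 1 ≤ rowCount T 0 0 + 1 := rowCount_succ_le hL 0 0
    rw [zero 0] at this
    omega
  · intro p
    by_contra! h
    have hn := rowCount_le (L := T) 1 (p + 1)
    let c : Fin n := ⟨rowCount T 0 p, by omega⟩
    have h1 := (entry_le_iff hL 1 c (p + 1)).2 h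
    have h2 : T (0, c) < T (1, c) := hL (Prod.mk_lt_mk_iff_left.2 (by decide))
    have h3 := (entry_le_iff hL 0 c p).1 (by omega)
    exact lt_irrefl _ h3

/-- Treating the rows symmetrically lets one computation of toggles serve both. -/
theorem coverAdj_iff {r s : Fin 2} (hrs : r ≠ s) (c c' : Fin n) (r' : Fin 2) :
    CoverAdj (r, c) (r', c') ↔
      r' = s ∧ c' = c ∨ r' = r ∧ ((c : ℕ) + 1 = c' ∨ (c' : ℕ) + 1 = c) := by
  simp only [CoverAdj, Prod.mk_covBy_mk_iff, Fin.covBy_iff, Nat.covBy_iff_add_one_eq]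
  simp only [Fin.ext_iff] at *
  omega

/-- The effect of a toggle on the row counts. -/
theorem rowCount_toggle {L : Fin 2 × Fin n → ℕ} (hL : StrictMono L) {r s : Fin 2} (hrs : r ≠ s)
    (j : ℕ) {a₀ a₁ a₂ b₀ b₁ b₂ : ℕ} (ha₀ : rowCount L r j = a₀)
    (ha₁ : rowCount L r (j + 1) = a₁) (ha₂ : rowCount L r (j + 2) = a₂)
    (hb₀ : rowCount L s j = b₀) (hb₁ : rowCount L s (j + 1) = b₁)
    (hb₂ : rowCount L s (j + 2) = b₂) :
    rowCount (toggle (j + 1) L) r (j + 1) =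
      a₀ + (if a₀ < a₁ ∧ (a₁ < a₂ ∨ b₁ < b₂ ∧ a₀ = b₁) then 1 else 0) +
        (if a₁ < a₂ ∧ ¬ (a₀ < a₁ ∨ b₀ < b₁ ∧ a₁ = b₀) then 1 else 0) := by
  classical
  have hL' := toggle_strictMono hL (j + 1)
  have m1 := rowCount_mono (L := L) r j.le_succ
  have m2 := rowCount_mono (L := L) r (j + 1).le_succ
  have m3 := rowCount_mono (L := L) s j.le_succ
  have m4 := rowCount_mono (L := L) s (j + 1).le_succ
  have s1 := rowCount_succ_le hL r j
  have s2 := rowCount_succ_le hL r (j + 1)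
  have s3 := rowCount_succ_le hL s j
  have s4 := rowCount_succ_le hL s (j + 1)
  have n2 := rowCount_le (L := L) r (j + 2)
  have n' := rowCount_le (L := toggle (j + 1) L) r (j + 1)
  simp only [Nat.succ_eq_add_one, Nat.add_assoc, Nat.reduceAdd, ha₀, ha₁, ha₂, hb₀, hb₁, hb₂]
    at m1 m2 m3 m4 s1 s2 s3 s4 n2
  have eq1 : ∀ c : Fin n, L (r, c) = j + 1 ↔ (c : ℕ) < a₁ ∧ a₀ ≤ c := fun c => by
    rw [entry_eq_iff hL, ha₀, ha₁]
  have eq2 : ∀ c : Fin n, L (r, c) = j + 1 + 1 ↔ (c : ℕ) < a₂ ∧ a₁ ≤ c := fun c => by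
    rw [entry_eq_iff hL, ha₁, ha₂]
  have eq3 : ∀ c : Fin n, L (s, c) = j + 1 ↔ (c : ℕ) < b₁ ∧ b₀ ≤ c := fun c => by
    rw [entry_eq_iff hL, hb₀, hb₁]
  have eq4 : ∀ c : Fin n, L (s, c) = j + 1 + 1 ↔ (c : ℕ) < b₂ ∧ b₁ ≤ c := fun c => by
    rw [entry_eq_iff hL, hb₁, hb₂]
  have le0 : ∀ c : Fin n, L (r, c) ≤ j ↔ (c : ℕ) < a₀ := fun c => by
    rw [entry_le_iff hL, ha₀]
  have adj1 : ∀ c : Fin n, (c : ℕ) = a₀ → a₀ < a₁ →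
      ((∃ x, CoverAdj (r, c) x ∧ L x = j + 1 + 1) ↔ a₁ < a₂ ∨ b₁ < b₂ ∧ a₀ = b₁) := by
    intro c hc h01
    constructor
    · rintro ⟨⟨r', c'⟩, hx, hl⟩
      rcases (coverAdj_iff hrs c c' r').1 hx with ⟨rfl, rfl⟩ | ⟨rfl, -⟩
      · rw [eq4] at hl; omega
      · rw [eq2] at hl; omega
    · rintro (h | h)
      · refine ⟨(r, ⟨a₁, by omega⟩), (coverAdj_iff hrs _ _ _).2 (Or.inr ⟨rfl, ?_⟩), (eq2 _).2 ?_⟩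
        · dsimp only; omega
        · dsimp only; omega
      · exact ⟨(s, c), (coverAdj_iff hrs _ _ _).2 (Or.inl ⟨rfl, rfl⟩), (eq4 _).2 (by omega)⟩
  have adj2 : ∀ c : Fin n, (c : ℕ) = a₁ → a₁ < a₂ →
      ((∃ x, CoverAdj (r, c) x ∧ L x = j + 1) ↔ a₀ < a₁ ∨ b₀ < b₁ ∧ a₁ = b₀) := by
    intro c hc h01
    constructor
    · rintro ⟨⟨r', c'⟩, hx, hl⟩
      rcases (coverAdj_iff hrs c c' r').1 hx with ⟨rfl, rfl⟩ | ⟨rfl, -⟩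
      · rw [eq3] at hl; omega
      · rw [eq1] at hl; omega
    · rintro (h | h)
      · refine ⟨(r, ⟨a₀, by omega⟩), (coverAdj_iff hrs _ _ _).2 (Or.inr ⟨rfl, ?_⟩), (eq1 _).2 ?_⟩
        · dsimp only; omega
        · dsimp only; omega
      · exact ⟨(s, c), (coverAdj_iff hrs _ _ _).2 (Or.inl ⟨rfl, rfl⟩), (eq3 _).2 (by omega)⟩
  -- Only column `a₀`, which may hold `j + 1`, and column `a₁`, which may hold `j + 2`, can change.
  have key : ∀ c : Fin n, (c : ℕ) < rowCount (toggle (j + 1) L) r (j + 1) ↔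
      (c : ℕ) < a₀ ∨ ((c : ℕ) = a₀ ∧ a₀ < a₁ ∧ (a₁ < a₂ ∨ b₁ < b₂ ∧ a₀ = b₁)) ∨
        ((c : ℕ) = a₁ ∧ a₁ < a₂ ∧ ¬ (a₀ < a₁ ∨ b₀ < b₁ ∧ a₁ = b₀)) := by
    intro c
    rw [← entry_le_iff hL', toggle]
    by_cases h1 : (c : ℕ) = a₀ ∧ a₀ < a₁
    · have e1 : L (r, c) = j + 1 := (eq1 c).2 (by omega)
      have e2 : ¬ j + 1 = j + 1 + 1 := by omega
      simp only [adj1 c h1.1 h1.2, e1, e2, true_and, false_and, if_false]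
      split_ifs <;> omega
    by_cases h2 : (c : ℕ) = a₁ ∧ a₁ < a₂
    · have e1 : L (r, c) = j + 1 + 1 := (eq2 c).2 (by omega)
      have e2 : ¬ j + 1 + 1 = j + 1 := by omega
      simp only [adj2 c h2.1 h2.2, e1, e2, true_and, false_and, if_false]
      split_ifs <;> omega
    have e1 : L (r, c) ≠ j + 1 := fun h => by rw [eq1] at h; omega
    have e2 : L (r, c) ≠ j + 1 + 1 := fun h => by rw [eq2] at h; omega
    simp only [e1, e2, false_and, if_false]
    have := le0 c
    omega
  generalize rowCount (toggle (j + 1) L) r (j + 1) = a at *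
  -- If the two counts differed, `key` would fail at the last column counted by the larger one or
  -- the first missed by the smaller.
  by_contra hne
  rcases lt_or_gt_of_ne hne with h | h
  · have := key ⟨a, by split_ifs at h <;> omega⟩
    dsimp only at this
    split_ifs at h <;> omega
  · have := key ⟨a - 1, by omega⟩
    dsimp only at this
    split_ifs at h <;> omega

theorem rowCount_toggle_of_ne {L : Fin 2 × Fin n → ℕ} (r : Fin 2) {i p : ℕ} (h : p ≠ i) :
    rowCount (toggle i L) r p = rowCount L r p := by
  unfold rowCount
  congr 1
  ext c
  simp only [Finset.mem_filter, Finset.mem_univ, true_and]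
  unfold toggle
  split_ifs <;> omega

theorem rowCount_toggles_of_lt {T : Fin 2 × Fin n → ℕ} (r : Fin 2) {k p : ℕ} (h : k < p) :
    rowCount (toggles T k) r p = rowCount T r p := by
  induction k with
  | zero => rfl
  | succ k ih => rw [toggles, rowCount_toggle_of_ne r (by omega), ih (by omega)]

theorem rowCount_toggles_of_le {T : Fin 2 × Fin n → ℕ} (r : Fin 2) {k p : ℕ} (h : p ≤ k) :
    rowCount (toggles T k) r p = rowCount (toggles T p) r p := by
  induction k, h using Nat.le_induction with
  | base => rfl
  | succ k hk ih => rw [toggles, rowCount_toggle_of_ne r (by omega), ih]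

-- `toggle i` affects only the count at `i`, so that count is final after `i` toggles, while counts
-- at larger indices are still those of `T`. This yields a recursion in `i`, solved by recording
-- whether the bullet has left the first row and whether it has reached the second.
open TwoRowPath in
theorem promotes_kPromoteLabeling {T : Fin 2 × Fin n → ℕ} (hT : IsInc d T) (hn : 0 < n) :
    Promotes d (rowCount T 0) (rowCount T 1) (rowCount (kPromoteLabeling d T) 0)
      (rowCount (kPromoteLabeling d T) 1) := by
  classical
  have h := twoRowPath hT hn
  rw [kPromoteLabeling_eq hT]
  intro i hi
  rw [rowCount_toggles_of_le 0 (show i ≤ d - 1 by omega),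
    rowCount_toggles_of_le 1 (show i ≤ d - 1 by omega)]
  induction i with
  | zero =>
    have h1 : ¬ Leaves (rowCount T 0) (rowCount T 1) 1 := by
      rintro ⟨m, m1, m2, m3⟩
      obtain rfl : m = 1 := by omega
      have := h.snd_le 0
      have := h.fst_zero; have := h.fst_one
      simp only [Nat.zero_add] at *
      omega
    have e : rowCount T 1 1 = 0 := by
      have := h.snd_le 0
      rw [h.fst_zero] at this
      exact Nat.le_zero.1 this
    simp [toggles, h1, not_drops_one, h.fst_zero, h.snd_zero, h.fst_one, e]
  | succ i ih =>
    have ih := ih (by omega)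
    have hs := (toggles_isInc hT i (by omega)).1
    have t0 := rowCount_toggle hs (r := 0) (s := 1) (by decide) i rfl
      (rowCount_toggles_of_lt 0 (by omega)) (rowCount_toggles_of_lt 0 (by omega)) rfl
      (rowCount_toggles_of_lt 1 (by omega)) (rowCount_toggles_of_lt 1 (by omega))
    have t1 := rowCount_toggle hs (r := 1) (s := 0) (by decide) i rfl
      (rowCount_toggles_of_lt 1 (by omega)) (rowCount_toggles_of_lt 1 (by omega)) rfl
      (rowCount_toggles_of_lt 0 (by omega)) (rowCount_toggles_of_lt 0 (by omega))
    have hd := drops_succ (α := rowCount T 0) (β := rowCount T 1) (p := i + 1) (by omega)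
    have hl := leaves_succ (α := rowCount T 0) (β := rowCount T 1) (p := i + 1)
    have l1 : ¬ Leaves (rowCount T 0) (rowCount T 1) (i + 1) →
        rowCount T 1 (i + 1) ≠ rowCount T 0 (i + 1) := fun h' e =>
      h' ⟨i + 1, by omega, le_rfl, e⟩
    -- A bullet that has left the first row must be in the second; this excludes an impossible case
    -- below.
    have ld : Leaves (rowCount T 0) (rowCount T 1) (i + 1) →
        Drops (rowCount T 0) (rowCount T 1) (i + 1) := by
      rintro ⟨m, m1, m2, m3⟩
      obtain ⟨m, rfl⟩ : ∃ t, m = t + 1 := ⟨m - 1, by omega⟩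
      have := h.snd_le m
      have := h.fst_mono m
      refine ⟨m, ?_, m2, by omega⟩
      by_contra h0
      obtain rfl : m = 0 := by omega
      have := h.fst_zero; have := h.fst_one
      simp only [Nat.zero_add] at *
      omega
    have p1 := h.fst_mono (i + 1)
    have p2 := h.fst_step (i + 1)
    have p3 := h.snd_mono (i + 1)
    have p4 := h.snd_step (i + 1)
    have p5 := h.snd_le (i + 1)
    have p6 := h.snd_le i
    have p7 := h.fst_mono i
    have p8 := h.fst_step i
    simp only [Nat.add_assoc, Nat.reduceAdd] at *
    rw [toggles]
    generalize rowCount (toggles T i) 0 i = a₀ at *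
    generalize rowCount (toggles T i) 1 i = b₀ at *
    generalize rowCount (toggle (i + 1) (toggles T i)) 0 (i + 1) = a' at *
    generalize rowCount (toggle (i + 1) (toggles T i)) 1 (i + 1) = b' at *
    generalize rowCount T 0 i = a at *
    generalize rowCount T 0 (i + 1) = a₁ at *
    generalize rowCount T 1 (i + 1) = b₁ at *
    generalize rowCount T 0 (i + 2) = a₂ at *
    generalize rowCount T 1 (i + 2) = b₂ at *
    generalize Leaves (rowCount T 0) (rowCount T 1) (i + 1) = C at *
    generalize Leaves (rowCount T 0) (rowCount T 1) (i + 2) = C' at *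
    generalize Drops (rowCount T 0) (rowCount T 1) (i + 1) = A at *
    generalize Drops (rowCount T 0) (rowCount T 1) (i + 2) = A' at *
    by_cases hC : C <;> by_cases hA : A <;> simp only [hC, hA, true_or, false_or, if_true,
      if_false, iff_true, not_true, not_false_iff, true_imp_iff, false_imp_iff] at * <;>
      simp only [hd, hl, if_true] <;> clear hd hl <;> split_ifs at * <;> omega

end TwoRows

/-! ### Averaging over promotion orbits -/

namespace IncTableau

instance {P : Type*} [PartialOrder P] [Fintype P] {q : ℕ} : Finite (IncTableau P q) := by
  refine Finite.of_injective (β := P → Fin (Fintype.card P - q + 1))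
    (fun T p => ⟨T.entry p, ?_⟩) ?_
  · have : T.entry p ∈ Set.Icc 1 (Fintype.card P - q) := T.range_eq ▸ Set.mem_range_self p
    exact Nat.lt_succ_of_le this.2
  · intro T U h
    refine IncTableau.ext (funext fun p => ?_)
    exact Fin.mk.inj_iff.1 (congrFun h p)

variable {n q : ℕ}

theorem entry_mem {P : Type*} [PartialOrder P] [Fintype P] {q : ℕ} (T : IncTableau P q) (p : P) :
    1 ≤ T.entry p ∧ T.entry p ≤ Fintype.card P - q :=
  (T.range_eq ▸ Set.mem_range_self p : T.entry p ∈ Set.Icc 1 (Fintype.card P - q))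

/-- After `k` promotions, the labels at most `d - k` of the second row fill, up to rotation, the
boxes of the first row which initially had labels exceeding `k`. -/
theorem entry_le_iff_kPromotion (T : IncTableau (Fin 2 × Fin n) q) (c : Fin n) {k : ℕ}
    (hk : k ≤ Fintype.card (Fin 2 × Fin n) - q) :
    T.entry (0, c) ≤ k ↔ Fintype.card (Fin 2 × Fin n) - q - k <
      ((kPromotion (Fin 2 × Fin n) q ^ k) T).entry (1, c.rev) := by
  set d := Fintype.card (Fin 2 × Fin n) - q
  have hn : 0 < n := c.pos
  let U : ℕ → IncTableau (Fin 2 × Fin n) q := fun k => (kPromotion (Fin 2 × Fin n) q ^ k) T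
  have hU : ∀ k, (U (k + 1)).entry = kPromoteLabeling d (U k).entry := fun k => by
    simp only [U, pow_succ', Equiv.Perm.mul_apply]
    rfl
  have key := TwoRowPath.snd_add_fst (n := n) (d := d)
    (α := fun k => rowCount (U k).entry 0) (β := fun k => rowCount (U k).entry 1)
    (fun k => twoRowPath (U k).isInc hn)
    (fun k => by simp only [hU k]; exact promotes_kPromoteLabeling (U k).isInc hn) hk
  have h0 : U 0 = T := rfl
  simp only [h0] at key
  -- Both sides become `c < α_0 k`, because `β_k (d - k) = n - α_0 k` and `c.rev = n - 1 - c`.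
  rw [← not_le, entry_le_iff T.strictMono, entry_le_iff (U k).strictMono, Fin.val_rev]
  have := c.isLt
  omega

theorem sum_orbit_comp {M X : Type*} [AddCommMonoid M] (g : Equiv.Perm X) (x : X)
    (hfin : (MulAction.orbit (Subgroup.zpowers g) x).Finite) (k : ℕ) (F : X → M) :
    ∑ z ∈ hfin.toFinset, F ((g ^ k) z) = ∑ z ∈ hfin.toFinset, F z := by
  refine Finset.sum_equiv (g ^ k) (fun z => ?_) fun _ _ => rfl
  simp only [Set.Finite.mem_toFinset]
  have : (g ^ k) z = (⟨g ^ k, Subgroup.pow_mem _ (Subgroup.mem_zpowers g) k⟩ :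
    Subgroup.zpowers g) • z := rfl
  rw [this, ← MulAction.orbit_eq_iff, ← MulAction.orbit_eq_iff, MulAction.orbit_smul]

theorem sum_orbit_entry_add_rev (T : IncTableau (Fin 2 × Fin n) q)
    (hfin : (MulAction.orbit (Subgroup.zpowers (kPromotion (Fin 2 × Fin n) q)) T).Finite)
    (c : Fin n) :
    ∑ z ∈ hfin.toFinset, (z.entry (0, c) + z.entry (1, c.rev)) =
      hfin.toFinset.card * (Fintype.card (Fin 2 × Fin n) - q + 1) := by
  set d := Fintype.card (Fin 2 × Fin n) - q with hd
  -- Both entries are written as counts of thresholds `k` in `0, …, d`, complementary for the first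
  -- row.
  have h1 : ∀ z : IncTableau (Fin 2 × Fin n) q,
      z.entry (0, c) + ∑ k ∈ Finset.range (d + 1), (if z.entry (0, c) ≤ k then 1 else 0) =
        d + 1 := by
    intro z
    have hz := entry_mem z (0, c)
    have : (Finset.range (d + 1)).filter (fun k => z.entry (0, c) ≤ k) =
        Finset.Ico (z.entry (0, c)) (d + 1) := by
      ext k; simp only [Finset.mem_filter, Finset.mem_range, Finset.mem_Ico]; omega
    rw [← Finset.card_filter, this, Nat.card_Ico]
    omega
  have h2 : ∀ z : IncTableau (Fin 2 × Fin n) q,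
      ∑ k ∈ Finset.range (d + 1), (if d - k < z.entry (1, c.rev) then 1 else 0) =
        z.entry (1, c.rev) := by
    intro z
    have hz := entry_mem z (1, c.rev)
    have : (Finset.range (d + 1)).filter (fun k => d - k < z.entry (1, c.rev)) =
        Finset.Ico (d + 1 - z.entry (1, c.rev)) (d + 1) := by
      ext k; simp only [Finset.mem_filter, Finset.mem_range, Finset.mem_Ico]; omega
    rw [← Finset.card_filter, this, Nat.card_Ico]
    omega
  have h3 : ∑ z ∈ hfin.toFinset, z.entry (1, c.rev) =
      ∑ z ∈ hfin.toFinset, ∑ k ∈ Finset.range (d + 1),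
        (if z.entry (0, c) ≤ k then 1 else 0) := by
    rw [Finset.sum_comm, ← Finset.sum_congr rfl fun z _ => h2 z, Finset.sum_comm]
    refine Finset.sum_congr rfl fun k hk => ?_
    -- For each fixed threshold, reindex the orbit by the `k`-th promotion.
    rw [← sum_orbit_comp _ _ hfin k]
    refine Finset.sum_congr rfl fun z _ => ?_
    rw [if_congr (entry_le_iff_kPromotion z c (by rw [Finset.mem_range] at hk; omega)) rfl rfl]
  rw [Finset.sum_add_distrib, h3, ← Finset.sum_add_distrib, Finset.sum_congr rfl fun z _ => h1 z,
    Finset.sum_const, smul_eq_mul]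

theorem sum_orbit_entry_add_rotateBox (T : IncTableau (Fin 2 × Fin n) q)
    (hfin : (MulAction.orbit (Subgroup.zpowers (kPromotion (Fin 2 × Fin n) q)) T).Finite)
    (s : Fin 2 × Fin n) :
    ∑ z ∈ hfin.toFinset, (z.entry s + z.entry (rotateBox s)) =
      hfin.toFinset.card * (Fintype.card (Fin 2 × Fin n) - q + 1) := by
  obtain ⟨r, c⟩ := s
  fin_cases r
  · exact sum_orbit_entry_add_rev T hfin c
  · rw [← sum_orbit_entry_add_rev T hfin c.rev]
    refine Finset.sum_congr rfl fun z _ => ?_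
    rw [Fin.rev_rev, add_comm]
    rfl

theorem sum_rotateBox {m n : ℕ} {M : Type*} [AddCommMonoid M] {S : Finset (Fin m × Fin n)}
    (hS : S.image rotateBox = S) (F : Fin m × Fin n → M) :
    ∑ s ∈ S, F (rotateBox s) = ∑ s ∈ S, F s := by
  have inv : Function.Involutive (rotateBox : Fin m × Fin n → Fin m × Fin n) := fun b => by
    simp [rotateBox]
  conv_rhs => rw [← hS]
  rw [Finset.sum_image inv.injective.injOn]

/-- Doubling pairs every box of `S` with its antipode without choosing representatives of the pairs.
-/
theorem two_mul_sum_orbit_sigma (T : IncTableau (Fin 2 × Fin n) q) {S : Finset (Fin 2 × Fin n)}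
    (hS : S.image rotateBox = S)
    (hfin : (MulAction.orbit (Subgroup.zpowers (kPromotion (Fin 2 × Fin n) q)) T).Finite) :
    2 * ∑ z ∈ hfin.toFinset, sigma S z =
      hfin.toFinset.card * (S.card * ((Fintype.card (Fin 2 × Fin n) - q : ℕ) + 1)) := by
  have h : ∀ z : IncTableau (Fin 2 × Fin n) q,
      2 * sigma S z = ∑ s ∈ S, ((z.entry s + z.entry (rotateBox s) : ℕ) : ℂ) := fun z => by
    simp only [Nat.cast_add, Finset.sum_add_distrib]
    rw [sum_rotateBox hS fun s => (z.entry s : ℂ), sigma, two_mul]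
  rw [Finset.mul_sum, Finset.sum_congr rfl fun z _ => h z, Finset.sum_comm]
  simp only [← Nat.cast_sum, sum_orbit_entry_add_rotateBox T hfin, Finset.sum_const, nsmul_eq_mul]
  push_cast
  ring

end IncTableau

theorem theorem6p2 (n q : ℕ) (S : Finset (Fin 2 × Fin n)) (hS : S.image rotateBox = S) :
    Homomesic (Subgroup.zpowers (IncTableau.kPromotion (Fin 2 × Fin n) q))
      (IncTableau.sigma S : IncTableau (Fin 2 × Fin n) q → ℂ) := by
  refine ⟨fun x => Set.toFinite _, ?_⟩
  have avg : ∀ x : IncTableau (Fin 2 × Fin n) q,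
      (1 / ((MulAction.orbit (Subgroup.zpowers (IncTableau.kPromotion (Fin 2 × Fin n) q))
        x).ncard : ℂ)) * ∑ᶠ z ∈ MulAction.orbit (Subgroup.zpowers
          (IncTableau.kPromotion (Fin 2 × Fin n) q)) x, IncTableau.sigma S z =
        S.card * ((Fintype.card (Fin 2 × Fin n) - q : ℕ) + 1) / 2 := by
    intro x
    have hfin := Set.toFinite
      (MulAction.orbit (Subgroup.zpowers (IncTableau.kPromotion (Fin 2 × Fin n) q)) x)
    have h := IncTableau.two_mul_sum_orbit_sigma x hS hfin
    have hc : (hfin.toFinset.card : ℂ) ≠ 0 := by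
      rw [Nat.cast_ne_zero, Finset.card_ne_zero]
      exact ⟨x, hfin.mem_toFinset.2 (MulAction.mem_orbit_self x)⟩
    rw [finsum_mem_eq_finite_toFinset_sum _ hfin, Set.ncard_eq_toFinset_card _ hfin]
    field_simp
    linear_combination h
  exact fun x y => (avg x).trans (avg y).symm
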